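/- Let $G$ be a finite simple graph and $q\ge 0$ an integer. In the $\operatorname{Z}_q$-forcing game on $G$ all vertices are initially white, and Blue, playing against White, repeatedly applies one of the following rules until all vertices are blue. Rule 1: for one token, Blue turns any white vertex blue. Rule 2: at no cost, if a blue vertex $v$ has exactly one white neighbor $w$, Blue may turn $w$ blue. Rule 3: let $B$ be the set of blue vertices and $W_1,\dots,W_r$ the vertex sets of the connected components of $G[V(G)\setminus B]$. Blue selects at least $q+1$ of the $W_i$ and announces the selection; White answers with a nonempty subset $\{W_{i_1},\dots,W_{i_\ell}\}$ of the selected components; at no cost, Blue may then apply Rule 2 in the graph $G[B\cup W_{i_1}\cup\dots\cup W_{i_\ell}]$. Let $\operatorname{Z}_q(G)$ be the least number of tokens with which Blue can turn all of $G$ blue, whatever White does. Let $n\ge 1$, $k\ge 2$ and $q\ge 2$ be integers, let $x\ge 0$ be an integer with $x\equiv q+1 \pmod 2$, and let $p=q+1+x$. Let $P_{n,k}$ be any graph obtained from the path on $n$ vertices by attaching to each vertex of the path at least $2$ and at most $k$ pendant vertices. Then \[\operatorname{Z}_q(P_{n,k})\le (p-2)\log_2(n)+p+k-q+q(k-1)+1,\]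 and, if $q\ge 3$, also \[2\log_3(2)\log_2\!\left(\tfrac{n}{200}\right)-2\le \operatorname{Z}_q(P_{n,k}).\] -/

import Mathlib

/-- With blue set `B` and white set `U` (disjoint from `B`), Rule 2 applied to the induced graph
`G[B ∪ U]` lets the blue vertex `v` turn `w` blue: `w` is the only white neighbour of `v` there. -/
def CanForce {V : Type*} (G : SimpleGraph V) (B U : Set V) (v w : V) : Prop :=
  v ∈ B ∧ w ∈ U ∧ G.Adj v w ∧ ∀ u ∈ U, G.Adj v u → u = w

/-- The connected components of `G[V \ B]`, where `B` is the set of blue vertices. -/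
abbrev WhiteComponent {V : Type*} (G : SimpleGraph V) (B : Set V) : Type _ :=
  (G.induce Bᶜ).ConnectedComponent

/-- The union of the vertex sets of the white components in `S`. -/
def whiteUnion {V : Type*} (G : SimpleGraph V) (B : Set V)
    (S : Finset (WhiteComponent G B)) : Set V :=
  {u | ∃ h : u ∈ Bᶜ, (G.induce Bᶜ).connectedComponentMk ⟨u, h⟩ ∈ S}

/-- `BlueWins G q t B`: in the `Z_q`-forcing game on `G`, continued from the state whose blue
vertices are those of `B`, Blue has a strategy that turns all vertices blue, whatever White does,
and that spends at most `t` further tokens.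

In `rule3`, `W` is Blue's selection of at least `q + 1` white components, `S` is White's nonempty
answer, and `x S` forces `y S` in `G[B ∪ ⋃ S]` is Blue's reply to that answer. A reply in which Blue
changes nothing would lead back to the same state, so it is not listed: it never helps Blue. -/
inductive BlueWins {V : Type*} (G : SimpleGraph V) (q : ℕ) : ℕ → Set V → Prop
  | done (t : ℕ) : BlueWins G q t Set.univ
  | rule1 (t : ℕ) (B : Set V) (v : V) (hv : v ∉ B)
      (h : BlueWins G q t (insert v B)) : BlueWins G q (t + 1) B
  | rule2 (t : ℕ) (B : Set V) (v w : V) (hvw : CanForce G B Bᶜ v w)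
      (h : BlueWins G q t (insert w B)) : BlueWins G q t B
  | rule3 (t : ℕ) (B : Set V) (W : Finset (WhiteComponent G B)) (hW : q + 1 ≤ W.card)
      (x y : Finset (WhiteComponent G B) → V)
      (hxy : ∀ S ⊆ W, S.Nonempty → CanForce G B (whiteUnion G B S) (x S) (y S))
      (h : ∀ S ⊆ W, S.Nonempty → BlueWins G q t (insert (y S) B)) : BlueWins G q t B

/-- The `q`-forcing number `Z_q(G)` of a finite graph: the fewest tokens with which Blue can turn
the whole graph blue, starting from all vertices white. (For a finite graph the set below is
nonempty, since Blue can pay for every vertex.) -/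
noncomputable def qForcingNumber {V : Type*} (q : ℕ) (G : SimpleGraph V) : ℕ :=
  sInf {t : ℕ | BlueWins G q t ∅}

/-- The caterpillar obtained from the path on `n` vertices by attaching `m i` pendant vertices to
the `i`-th vertex of the path. The graphs `P_{n,k}` are those with `2 ≤ m i ≤ k` for all `i`. -/
def caterpillar (n : ℕ) (m : Fin n → ℕ) : SimpleGraph (Fin n ⊕ (Σ i : Fin n, Fin (m i))) where
  Adj a b :=
    match a, b with
    | Sum.inl i, Sum.inl j => (SimpleGraph.pathGraph n).Adj i j
    | Sum.inl i, Sum.inr l => l.1 = i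
    | Sum.inr l, Sum.inl i => l.1 = i
    | Sum.inr _, Sum.inr _ => False
  symm := by
    constructor
    rintro (i | l) (j | l') h
    · exact SimpleGraph.Adj.symm h
    · exact h
    · exact h
    · exact h
  loopless := by
    constructor
    rintro (i | l) h
    · exact (SimpleGraph.pathGraph n).loopless.irrefl i h
    · exact h

/-! Lower bound: White maintains a conceded set containing every blue vertex, with at most three
vertices on its boundary, each having two neighbours outside. Rule 2 cannot leave such a set
(`Blocked`). Since `q + 1 ≥ 4`, some answer to Rule 3 keeps the forced vertex inside it
(`card_le_of_sequential_forces`), so only tokens make progress. Every second token can cut an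
interval of length `L` into three, and White keeps the longest. Hence `L + 2` shrinks by a factor of
at most 3 per two tokens, which gives `n < 3 * √3 ^ t`.

Upper bound: more than `q` blue spine vertices with white leaves give a free Rule 3 move on one leaf
each. When free moves run out, both ends of every white spine run are such vertices, so at most `q /
2` runs remain. Two adjacent tokens halve a run, so `2 * (q / 2)` tokens per round and `Nat.log 2 n`
rounds colour the spine; at most `q * (k - 1)` tokens on leaves finish. -/

/-! ### Blocked sets and Rule 3 -/

open Classical in
-- White answers with all of `W`, then drops the component just forced into, and repeats. A forcing
-- vertex sees no other component still in the answer, so the forcing vertices are distinct, and all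
-- of them lie in `D`.
theorem card_le_of_sequential_forces {V : Type*} {G : SimpleGraph V} {B C : Set V} (hBC : B ⊆ C)
    {D : Finset V} (hD : ∀ v ∈ C, (∃ w, w ∉ C ∧ G.Adj v w) → v ∈ D)
    {W : Finset (WhiteComponent G B)} {x y : Finset (WhiteComponent G B) → V}
    (hxy : ∀ S ⊆ W, S.Nonempty → CanForce G B (whiteUnion G B S) (x S) (y S))
    (hy : ∀ S ⊆ W, S.Nonempty → y S ∉ C) : W.card ≤ D.card := by
  have key : ∀ S : Finset (WhiteComponent G B), S ⊆ W →
      ∃ T ⊆ D, T.card = S.card ∧ ∀ v ∈ T, ∃ w ∈ whiteUnion G B S, G.Adj v w := by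
    intro S
    induction S using Finset.strongInduction with
    | H S ih =>
      intro hSW
      rcases S.eq_empty_or_nonempty with rfl | hS
      · exact ⟨∅, by simp, by simp, by simp⟩
      obtain ⟨hxB, ⟨hyB, hyS⟩, hadj, huniq⟩ := hxy S hSW hS
      set κ := (G.induce Bᶜ).connectedComponentMk ⟨y S, hyB⟩ with hκ
      have hsub : S.erase κ ⊆ S := Finset.erase_subset _ _
      obtain ⟨T, hTD, hTc, hT⟩ := ih (S.erase κ) (Finset.erase_ssubset hyS) (hsub.trans hSW)
      have hmono : whiteUnion G B (S.erase κ) ⊆ whiteUnion G B S :=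
        fun u ⟨h, hu⟩ => ⟨h, hsub hu⟩
      have hxT : x S ∉ T := by
        intro hx
        obtain ⟨w, hw, hvw⟩ := hT _ hx
        have hwy := huniq w (hmono hw) hvw
        subst hwy
        obtain ⟨h, hw⟩ := hw
        exact (Finset.ne_of_mem_erase hw) rfl
      refine ⟨insert (x S) T, ?_, ?_, ?_⟩
      · exact Finset.insert_subset (hD _ (hBC hxB) ⟨y S, hy S hSW hS, hadj⟩) hTD
      · rw [Finset.card_insert_of_notMem hxT, hTc, Finset.card_erase_add_one hyS]
      · intro v hv
        rcases Finset.mem_insert.1 hv with rfl | hv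
        · exact ⟨y S, ⟨hyB, hyS⟩, hadj⟩
        · obtain ⟨w, hw, hvw⟩ := hT v hv
          exact ⟨w, hmono hw, hvw⟩
  obtain ⟨T, hTD, hTc, -⟩ := key W subset_rfl
  rw [← hTc]
  exact Finset.card_le_card hTD

/-- At most three blue vertices have white neighbours, and each of them has two. -/
def Blocked {V : Type*} (G : SimpleGraph V) (C : Set V) : Prop :=
  (∃ D : Finset V, D.card ≤ 3 ∧ ∀ v ∈ C, (∃ w, w ∉ C ∧ G.Adj v w) → v ∈ D) ∧
    ∀ v ∈ C, ∀ w, w ∉ C → G.Adj v w → ∃ u, u ∉ C ∧ G.Adj v u ∧ u ≠ w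

abbrev CaterpillarVertex {n : ℕ} (m : Fin n → ℕ) : Type := Fin n ⊕ (Σ i : Fin n, Fin (m i))

/-! ### Adjacency in the caterpillar -/

section Caterpillar

variable {n : ℕ} {m : Fin n → ℕ}

theorem caterpillar_adj_inl_inl {i j : Fin n} :
    (caterpillar n m).Adj (Sum.inl i) (Sum.inl j) ↔ i.1 + 1 = j.1 ∨ j.1 + 1 = i.1 :=
  SimpleGraph.pathGraph_adj

theorem caterpillar_adj_inl_inr {i : Fin n} {l : Σ i : Fin n, Fin (m i)} :
    (caterpillar n m).Adj (Sum.inl i) (Sum.inr l) ↔ l.1 = i := Iff.rfl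

theorem caterpillar_adj_inr_inl {i : Fin n} {l : Σ i : Fin n, Fin (m i)} :
    (caterpillar n m).Adj (Sum.inr l) (Sum.inl i) ↔ l.1 = i := Iff.rfl

theorem not_caterpillar_adj_inr_inr {l l' : Σ i : Fin n, Fin (m i)} :
    ¬ (caterpillar n m).Adj (Sum.inr l) (Sum.inr l') := fun h => h

/-! ### White's strategy -/

/-- The blue set that White concedes: the spine between `a` and `b` stays white except at `c`, and
so do the leaves of the vertices from `a` to `b` except those of `c`. -/
def conceded (m : Fin n → ℕ) (a b c : ℕ) : Set (CaterpillarVertex m) :=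
  {v | match v with
    | Sum.inl i => ¬ (a < i.1 ∧ i.1 < b ∧ i.1 ≠ c)
    | Sum.inr l => ¬ (a ≤ l.1.1 ∧ l.1.1 ≤ b ∧ l.1.1 ≠ c)}

theorem inl_mem_conceded {a b c : ℕ} {i : Fin n} :
    (Sum.inl i : CaterpillarVertex m) ∈ conceded m a b c ↔ ¬ (a < i.1 ∧ i.1 < b ∧ i.1 ≠ c) :=
  Iff.rfl

theorem inr_mem_conceded {a b c : ℕ} {l : Σ i : Fin n, Fin (m i)} :
    (Sum.inr l : CaterpillarVertex m) ∈ conceded m a b c ↔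
      ¬ (a ≤ l.1.1 ∧ l.1.1 ≤ b ∧ l.1.1 ≠ c) := Iff.rfl

theorem conceded_mono {a b c a' b' c' : ℕ} (ha : a ≤ a') (hb : b' ≤ b)
    (hc : c = c' ∨ c < a' ∨ b' < c) : conceded m a b c ⊆ conceded m a' b' c' := by
  rintro (i | l) h
  · rw [inl_mem_conceded] at h ⊢; omega
  · rw [inr_mem_conceded] at h ⊢; omega

theorem conceded_subset_split {a b c s : ℕ} (hc : c < a ∨ b < c) :
    conceded m a b c ⊆ conceded m a b s := by
  rintro (i | l) h
  · rw [inl_mem_conceded] at h ⊢; omega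
  · rw [inr_mem_conceded] at h ⊢; omega

/-- The spine vertex that a vertex is or hangs from. -/
def spineIndex : CaterpillarVertex m → ℕ
  | Sum.inl i => i.1
  | Sum.inr l => l.1.1

theorem mem_conceded_of_spineIndex {a b c : ℕ} {v : CaterpillarVertex m}
    (h : spineIndex v < a ∨ b < spineIndex v ∨ spineIndex v = c) : v ∈ conceded m a b c := by
  rcases v with i | l
  · rw [inl_mem_conceded]; simp only [spineIndex] at h; omega
  · rw [inr_mem_conceded]; simp only [spineIndex] at h; omega

theorem spineIndex_of_notMem_conceded {a b c : ℕ} {v : CaterpillarVertex m}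
    (h : v ∉ conceded m a b c) : a ≤ spineIndex v ∧ spineIndex v ≤ b ∧ spineIndex v ≠ c := by
  by_contra hv
  exact h (mem_conceded_of_spineIndex (by omega))

open Classical in
-- The boundary lies in the spine vertices `a`, `b`, `c`. The ends keep two white leaves each; a
-- split point at distance at least 2 from both ends keeps its two white spine neighbours.
theorem blocked_conceded (hm : ∀ i, 2 ≤ m i) {a b c : ℕ} (hb : b < n)
    (hc : c < a ∨ b < c ∨ (a + 2 ≤ c ∧ c + 2 ≤ b)) :
    Blocked (caterpillar n m) (conceded m a b c) := by
  have bdry : ∀ v ∈ conceded m a b c, ∀ w, w ∉ conceded m a b c → (caterpillar n m).Adj v w →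
      ∃ i : Fin n, v = Sum.inl i ∧ (i.1 = a ∨ i.1 = b ∨ i.1 = c) ∧
        (i.1 = c → a + 2 ≤ c ∧ c + 2 ≤ b) ∧ a ≤ i.1 ∧ i.1 ≤ b := by
    rintro (i | l) hv (j | l') hw hvw
    · rw [inl_mem_conceded] at hv hw
      rw [caterpillar_adj_inl_inl] at hvw
      exact ⟨i, rfl, by omega, by omega, by omega, by omega⟩
    · rw [inl_mem_conceded] at hv
      rw [inr_mem_conceded] at hw
      rw [caterpillar_adj_inl_inr] at hvw
      subst hvw
      exact ⟨_, rfl, by omega, by omega, by omega, by omega⟩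
    · rw [inr_mem_conceded] at hv
      rw [inl_mem_conceded] at hw
      rw [caterpillar_adj_inr_inl] at hvw
      subst hvw
      omega
    · exact absurd hvw not_caterpillar_adj_inr_inr
  constructor
  · let f : ℕ → CaterpillarVertex m → Prop := fun s v => ∃ i : Fin n, v = Sum.inl i ∧ i.1 = s
    have hf : ∀ s, ((Finset.univ : Finset (CaterpillarVertex m)).filter (f s)).card ≤ 1 := by
      intro s
      rw [Finset.card_le_one]
      intro v hv w hw
      obtain ⟨-, i, rfl, hi⟩ := Finset.mem_filter.1 hv
      obtain ⟨-, j, rfl, hj⟩ := Finset.mem_filter.1 hw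
      rw [Fin.ext (hi.trans hj.symm)]
    refine ⟨(Finset.univ.filter (f a) ∪ Finset.univ.filter (f b)) ∪ Finset.univ.filter (f c),
      ?_, ?_⟩
    · have h1 := Finset.card_union_le (Finset.univ.filter (f a) ∪ Finset.univ.filter (f b))
        (Finset.univ.filter (f c))
      have h2 := Finset.card_union_le (Finset.univ.filter (f a)) (Finset.univ.filter (f b))
      have := hf a
      have := hf b
      have := hf c
      omega
    · rintro v hv ⟨w, hw, hvw⟩
      obtain ⟨i, rfl, hi, -⟩ := bdry v hv w hw hvw
      simp only [Finset.mem_union, Finset.mem_filter, Finset.mem_univ, true_and, f]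
      rcases hi with h | h | h
      · exact Or.inl (Or.inl ⟨i, rfl, h⟩)
      · exact Or.inl (Or.inr ⟨i, rfl, h⟩)
      · exact Or.inr ⟨i, rfl, h⟩
  · intro v hv w hw hvw
    obtain ⟨i, rfl, hi, hic, hai, hib⟩ := bdry v hv w hw hvw
    suffices ∃ u u' : CaterpillarVertex m, u ∉ conceded m a b c ∧ u' ∉ conceded m a b c ∧
        (caterpillar n m).Adj (Sum.inl i) u ∧ (caterpillar n m).Adj (Sum.inl i) u' ∧ u ≠ u' by
      obtain ⟨u, u', hu, hu', h, h', hne⟩ := this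
      by_cases huw : u = w
      · exact ⟨u', hu', h', fun h => hne (huw.trans h.symm)⟩
      · exact ⟨u, hu, h, huw⟩
    by_cases h : i.1 = c
    · obtain ⟨h1, h2⟩ := hic h
      have hbn : c + 1 < n := by omega
      refine ⟨Sum.inl ⟨c - 1, by omega⟩, Sum.inl ⟨c + 1, hbn⟩, ?_, ?_, ?_, ?_, ?_⟩
      · rw [inl_mem_conceded]; simp only; omega
      · rw [inl_mem_conceded]; simp only; omega
      · rw [caterpillar_adj_inl_inl]; simp only; omega
      · rw [caterpillar_adj_inl_inl]; simp only; omega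
      · intro h'
        have := congrArg Fin.val (Sum.inl.inj h')
        simp only at this
        omega
    · refine ⟨Sum.inr ⟨i, ⟨0, by have := hm i; omega⟩⟩, Sum.inr ⟨i, ⟨1, by have := hm i; omega⟩⟩,
        ?_, ?_, rfl, rfl, by simp⟩
      · rw [inr_mem_conceded]; simp only; omega
      · rw [inr_mem_conceded]; simp only; omega

/-- A `c` outside `[a, b]` encodes an unsplit interval. A split interval is allowed one more factor
`√3`, since one token has already been spent on it. -/
theorem length_le_of_blueWins (hm : ∀ i, 2 ≤ m i) {q : ℕ} (hq : 3 ≤ q) {t : ℕ}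
    {B : Set (CaterpillarVertex m)} (h : BlueWins (caterpillar n m) q t B) :
    ∀ a b c : ℕ, a ≤ b → b < n → B ⊆ conceded m a b c →
      ((c < a ∨ b < c) → (b : ℝ) - a ≤ 3 * √3 ^ t - 2) ∧
      ((a + 2 ≤ c ∧ c + 2 ≤ b) → (b : ℝ) - a ≤ 3 * √3 ^ (t + 1) - 2) := by
  have hs2 : √3 * √3 = (3 : ℝ) := Real.mul_self_sqrt (by norm_num)
  -- Trimming an end costs length 2, and `3 * (5 / 3 - 1) = 2` is just enough to pay for it.
  have hs1 : (5 / 3 : ℝ) ≤ √3 := Real.le_sqrt_of_sq_le (by norm_num)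
  have hpow : ∀ t : ℕ, (1 : ℝ) ≤ √3 ^ t := fun t => one_le_pow₀ (by linarith)
  have hsucc : ∀ t : ℕ, (5 / 3 : ℝ) * √3 ^ t ≤ √3 ^ (t + 1) := fun t => by
    rw [pow_succ']
    exact mul_le_mul_of_nonneg_right hs1 (by positivity)
  have hsucc2 : ∀ t : ℕ, √3 ^ (t + 1 + 1) = (3 : ℝ) * √3 ^ t := fun t => by
    rw [pow_succ, pow_succ, mul_assoc, hs2, mul_comm]
  induction h with
  | done t =>
    intro a b c hab hb hB
    -- In both cases `c ≠ a`, so a leaf of `a` is never conceded.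
    have hmem : (Sum.inr ⟨⟨a, by omega⟩, ⟨0, by have := hm ⟨a, by omega⟩; omega⟩⟩ :
        CaterpillarVertex m) ∈ conceded m a b c := hB (Set.mem_univ _)
    rw [inr_mem_conceded] at hmem
    simp only at hmem
    constructor <;> intro <;> omega
  | rule1 t B v hv h ih =>
    intro a b c hab hb hB
    have h0 := hpow t
    have h1 := hsucc t
    have h2 := hsucc2 t
    have h3 := hsucc (t + 1)
    by_cases hvC : v ∈ conceded m a b c
    · obtain ⟨i1, i2⟩ := ih a b c hab hb (Set.insert_subset hvC hB)
      exact ⟨fun hc => by linarith [i1 hc], fun hc => by linarith [i2 hc]⟩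
    obtain ⟨hva, hvb, hvc⟩ := spineIndex_of_notMem_conceded hvC
    set s := spineIndex v with hs
    constructor
    · intro hc
      by_cases hsa : s ≤ a + 1
      · by_cases hl : a + 2 ≤ b
        · have := (ih (a + 2) b c hl hb (Set.insert_subset
            (mem_conceded_of_spineIndex (by omega))
            (hB.trans (conceded_mono (by omega) le_rfl (by omega))))).1 (by omega)
          push_cast at this
          linarith
        · have : (b : ℝ) ≤ a + 1 := by exact_mod_cast (by omega : b ≤ a + 1)
          linarith
      by_cases hsb : b ≤ s + 1
      · have := (ih a (b - 2) c (by omega) (by omega) (Set.insert_subset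
            (mem_conceded_of_spineIndex (by omega))
            (hB.trans (conceded_mono le_rfl (by omega) (by omega))))).1 (by omega)
        have hb2 : ((b - 2 : ℕ) : ℝ) = b - 2 := by
          rw [Nat.cast_sub (by omega)]; norm_num
        rw [hb2] at this
        linarith
      · exact (ih a b s hab hb (Set.insert_subset (mem_conceded_of_spineIndex (by omega))
          (hB.trans (conceded_subset_split hc)))).2 (by omega)
    · intro hc
      have piece : ∀ a' b' : ℕ, a ≤ a' → b' ≤ b → (c < a' ∨ b' < c) → (s < a' ∨ b' < s) →
          (b' : ℝ) - a' ≤ 3 * √3 ^ t - 2 := by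
        intro a' b' ha' hb' hc' hs'
        by_cases hl : a' ≤ b'
        · exact (ih a' b' c hl (by omega) (Set.insert_subset
            (mem_conceded_of_spineIndex (by omega))
            (hB.trans (conceded_mono ha' hb' (Or.inl rfl))))).1 (by omega)
        · have : (b' : ℝ) < a' := by exact_mod_cast (by omega : b' < a')
          linarith
      have hpred : ∀ k : ℕ, 1 ≤ k → ((k - 1 : ℕ) : ℝ) = k - 1 := fun k hk => by
        rw [Nat.cast_sub hk]; norm_num
      -- Removing `k`, `l` leaves pieces of total length `b - a - 4`; three bounds `3 * √3 ^ t - 2`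
      -- then add up to exactly the claim.
      have three : ∀ k l : ℕ, a ≤ k → k < l → l ≤ b → 1 ≤ l →
          (c = k ∧ s = l ∨ c = l ∧ s = k) → (b : ℝ) - a ≤ 3 * √3 ^ (t + 1 + 1) - 2 := by
        intro k l hk hkl hl hl1 hcs
        have p2 := piece (k + 1) (l - 1) (by omega) (by omega) (by omega) (by omega)
        have p3 := piece (l + 1) b (by omega) le_rfl (by omega) (by omega)
        rw [hpred l hl1] at p2
        push_cast at p2 p3
        -- For `k = 0` the left piece is empty and `k - 1` would truncate.
        rcases Nat.eq_zero_or_pos k with rfl | hk0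
        · have : (a : ℝ) = 0 := by exact_mod_cast (by omega : a = 0)
          push_cast at p2
          linarith
        · have p1 := piece a (k - 1) le_rfl (by omega) (by omega) (by omega)
          rw [hpred k hk0] at p1
          linarith
      rcases lt_or_gt_of_ne hvc with h | h
      · exact three s c hva h (by omega) (by omega) (Or.inr ⟨rfl, rfl⟩)
      · exact three c s (by omega) h hvb (by omega) (Or.inl ⟨rfl, rfl⟩)
  | rule2 t B v w hvw h ih =>
    intro a b c hab hb hB
    by_cases hw : w ∈ conceded m a b c
    · exact ih a b c hab hb (Set.insert_subset hw hB)
    · suffices ¬ (c < a ∨ b < c ∨ (a + 2 ≤ c ∧ c + 2 ≤ b)) from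
        ⟨fun hc => by omega, fun hc => by omega⟩
      intro hc
      obtain ⟨hv, hwB, hadj, huniq⟩ := hvw
      obtain ⟨u, hu, hvu, hne⟩ := (blocked_conceded hm hb hc).2 v (hB hv) w hw hadj
      exact hne (huniq u (fun h => hu (hB h)) hvu)
  | rule3 t B W hW x y hxy h ih =>
    intro a b c hab hb hB
    by_cases hy : ∃ S ⊆ W, S.Nonempty ∧ y S ∈ conceded m a b c
    · obtain ⟨S, hS, hne, hyS⟩ := hy
      exact ih S hS hne a b c hab hb (Set.insert_subset hyS hB)
    · suffices ¬ (c < a ∨ b < c ∨ (a + 2 ≤ c ∧ c + 2 ≤ b)) from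
        ⟨fun hc => by omega, fun hc => by omega⟩
      intro hc
      push Not at hy
      obtain ⟨D, hD3, hD⟩ := (blocked_conceded hm hb hc).1
      have := card_le_of_sequential_forces hB hD hxy hy
      omega

theorem lt_of_blueWins_empty (hm : ∀ i, 2 ≤ m i) (hn : 1 ≤ n) {q : ℕ} (hq : 3 ≤ q) {t : ℕ}
    (h : BlueWins (caterpillar n m) q t ∅) : (n : ℝ) < 3 * √3 ^ t := by
  -- The whole spine, with `c = n` standing for no split.
  have := (length_le_of_blueWins hm hq h 0 (n - 1) n (Nat.zero_le _) (by omega)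
    (Set.empty_subset _)).1 (by omega)
  rw [Nat.cast_sub hn] at this
  push_cast at this
  linarith

/-! ### Blue's strategy -/

theorem BlueWins.mono {V : Type*} {G : SimpleGraph V} {q t : ℕ} {B : Set V}
    (h : BlueWins G q t B) : ∀ {t' : ℕ}, t ≤ t' → BlueWins G q t' B := by
  induction h with
  | done t => exact fun _ => .done _
  | rule1 t B v hv h ih =>
    intro t' ht
    obtain ⟨s, rfl⟩ : ∃ s, t' = s + 1 := ⟨t' - 1, by omega⟩
    exact .rule1 _ _ v hv (ih (by omega))
  | rule2 t B v w hvw h ih => exact fun ht => .rule2 _ _ v w hvw (ih ht)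
  | rule3 t B W hW x y hxy h ih =>
    exact fun ht => .rule3 _ _ W hW x y hxy fun S hS hne => ih S hS hne ht

open Classical in
theorem BlueWins.of_tokens {V : Type*} {G : SimpleGraph V} {q t : ℕ} (F : Finset V) :
    ∀ {B : Set V}, BlueWins G q t (B ∪ F) → BlueWins G q (t + F.card) B := by
  induction F using Finset.induction_on with
  | empty => intro B h; simpa using h
  | insert v F hv ih =>
    intro B h
    rw [Finset.card_insert_of_notMem hv]
    have h' : BlueWins G q t (insert v B ∪ F) := by
      convert h using 1
      ext u
      simp only [Set.mem_union, Set.mem_insert_iff, Finset.coe_insert]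
      tauto
    by_cases hvB : v ∈ B
    · rw [Set.insert_eq_of_mem hvB] at h'
      exact (ih h').mono (by omega)
    · exact .rule1 _ _ v hvB (ih h')

/-! ### Tame positions -/

/-- `i` is the index of a white vertex of the spine. -/
def SpineWhite (B : Set (CaterpillarVertex m)) (i : ℕ) : Prop :=
  ∃ h : i < n, (Sum.inl ⟨i, h⟩ : CaterpillarVertex m) ∉ B

theorem SpineWhite.anti {B B' : Set (CaterpillarVertex m)} (h : B ⊆ B') {i : ℕ}
    (hi : SpineWhite B' i) : SpineWhite B i :=
  ⟨hi.1, fun hB => hi.2 (h hB)⟩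

theorem not_spineWhite_iff {B : Set (CaterpillarVertex m)} {i : ℕ} (hi : i < n) :
    ¬ SpineWhite B i ↔ (Sum.inl ⟨i, hi⟩ : CaterpillarVertex m) ∈ B := by
  simp [SpineWhite, hi]

/-- Both ends of the spine are blue, and no blue vertex of the spine lies between two white ones. -/
structure Tame (B : Set (CaterpillarVertex m)) : Prop where
  between : ∀ i, SpineWhite B i → SpineWhite B (i + 2) → SpineWhite B (i + 1)
  first : ¬ SpineWhite B 0
  last : ∀ i, SpineWhite B i → i + 1 < n

theorem Tame.of_spine {B B' : Set (CaterpillarVertex m)} (hB : Tame B) (hBB : B ⊆ B')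
    (h : ∀ i, SpineWhite B i → ¬ SpineWhite B' i →
      SpineWhite B' (i - 1) → SpineWhite B' (i + 1) → False) : Tame B' where
  between i h0 h2 := by
    by_contra h1
    exact h (i + 1) (hB.between i (h0.anti hBB) (h2.anti hBB)) h1 h0 h2
  first h0 := hB.first (h0.anti hBB)
  last i hi := hB.last i (hi.anti hBB)

/-- A spine vertex forced from the spine has a blue spine neighbour. A force from a leaf could break
tameness, so Blue avoids those. -/
theorem Tame.insert_force {B : Set (CaterpillarVertex m)} (hB : Tame B) {i : Fin n}
    {w : CaterpillarVertex m} (h : CanForce (caterpillar n m) B Bᶜ (Sum.inl i) w) :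
    Tame (insert w B) := by
  refine hB.of_spine (Set.subset_insert _ _) fun j hj hj' hl hr => ?_
  rw [not_spineWhite_iff hj.1] at hj'
  have hw := (Set.mem_insert_iff.1 hj').resolve_right hj.2
  subst hw
  have hadj := caterpillar_adj_inl_inl.1 h.2.2.1
  simp only at hadj
  rcases hadj with hadj | hadj
  · refine hl.2 (Set.mem_insert_of_mem _ ?_)
    convert h.1
    omega
  · refine hr.2 (Set.mem_insert_of_mem _ ?_)
    convert h.1

theorem Tame.insert_leaf {B : Set (CaterpillarVertex m)} (hB : Tame B)
    (l : Σ i : Fin n, Fin (m i)) : Tame (insert (Sum.inr l) B) := by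
  refine hB.of_spine (Set.subset_insert _ _) fun j hj hj' _ _ => ?_
  rw [not_spineWhite_iff hj.1] at hj'
  exact hj.2 ((Set.mem_insert_iff.1 hj').resolve_left (by simp))

/-! ### Free moves -/

open Classical in
/-- The blue vertices of the spine that have a white leaf. -/
noncomputable def leafy (B : Set (CaterpillarVertex m)) : Finset (Fin n) :=
  Finset.univ.filter fun i => (Sum.inl i : CaterpillarVertex m) ∈ B ∧
    ∃ j : Fin (m i), (Sum.inr ⟨i, j⟩ : CaterpillarVertex m) ∉ B

theorem mem_leafy {B : Set (CaterpillarVertex m)} {i : Fin n} :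
    i ∈ leafy B ↔ (Sum.inl i : CaterpillarVertex m) ∈ B ∧
      ∃ j : Fin (m i), (Sum.inr ⟨i, j⟩ : CaterpillarVertex m) ∉ B := by
  simp [leafy]

theorem eq_of_leaf_component_eq {B : Set (CaterpillarVertex m)} {l : Σ i : Fin n, Fin (m i)}
    (hl : (Sum.inr l : CaterpillarVertex m) ∈ Bᶜ) (hi : (Sum.inl l.1 : CaterpillarVertex m) ∈ B)
    {u : CaterpillarVertex m} (hu : u ∈ Bᶜ)
    (h : ((caterpillar n m).induce Bᶜ).connectedComponentMk ⟨Sum.inr l, hl⟩ =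
      ((caterpillar n m).induce Bᶜ).connectedComponentMk ⟨u, hu⟩) : u = Sum.inr l := by
  obtain ⟨p⟩ := SimpleGraph.ConnectedComponent.exact h
  cases p with
  | nil => rfl
  | @cons _ v _ hadj p =>
    obtain ⟨v, hv⟩ := v
    have hadj' : (caterpillar n m).Adj (Sum.inr l) v := hadj
    rcases v with j | l'
    · rw [caterpillar_adj_inr_inl] at hadj'
      subst hadj'
      exact absurd hi hv
    · exact absurd hadj' not_caterpillar_adj_inr_inr

open Classical in
-- A white leaf of a blue spine vertex is a component by itself. Blue selects one per leafy vertex;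
-- any answer isolates at least one of them as its parent's only white neighbour.
theorem blueWins_of_lt_card_leafy {q t : ℕ} {B : Set (CaterpillarVertex m)}
    (hq : q < (leafy B).card)
    (H : ∀ l : Σ i : Fin n, Fin (m i), (Sum.inr l : CaterpillarVertex m) ∉ B →
      BlueWins (caterpillar n m) q t (insert (Sum.inr l) B)) :
    BlueWins (caterpillar n m) q t B := by
  have hw : ∀ i : leafy B, ∃ j : Fin (m i.1), (Sum.inr ⟨i.1, j⟩ : CaterpillarVertex m) ∉ B :=
    fun i => (mem_leafy.1 i.2).2
  choose lf hlf using hw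
  have hblue : ∀ i : leafy B, (Sum.inl i.1 : CaterpillarVertex m) ∈ B :=
    fun i => (mem_leafy.1 i.2).1
  let f : leafy B → WhiteComponent (caterpillar n m) B := fun i =>
    ((caterpillar n m).induce Bᶜ).connectedComponentMk ⟨Sum.inr ⟨i.1, lf i⟩, hlf i⟩
  have hf : Function.Injective f := by
    intro i j hij
    have := eq_of_leaf_component_eq (hlf i) (hblue i) (hlf j) hij
    have := congrArg Sigma.fst (Sum.inr.inj this)
    exact Subtype.ext this.symm
  have hforce : ∀ S ⊆ Finset.univ.image f, S.Nonempty → ∃ i : leafy B,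
      CanForce (caterpillar n m) B (whiteUnion (caterpillar n m) B S) (Sum.inl i.1)
        (Sum.inr ⟨i.1, lf i⟩) := by
    intro S hS ⟨κ, hκ⟩
    obtain ⟨i, -, rfl⟩ := Finset.mem_image.1 (hS hκ)
    refine ⟨i, hblue i, ⟨hlf i, hκ⟩, rfl, ?_⟩
    rintro u ⟨hu, huS⟩ hadj
    obtain ⟨j, -, hj⟩ := Finset.mem_image.1 (hS huS)
    have huj := eq_of_leaf_component_eq (hlf j) (hblue j) hu hj
    subst huj
    have hji : j = i := Subtype.ext (caterpillar_adj_inl_inr.1 hadj)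
    rw [hji]
  have hne : Nonempty (leafy B) := by
    have : 0 < (leafy B).card := by omega
    obtain ⟨i, hi⟩ := Finset.card_pos.1 this
    exact ⟨⟨i, hi⟩⟩
  have hforce' : ∀ S : Finset (WhiteComponent (caterpillar n m) B), ∃ i : leafy B,
      S ⊆ Finset.univ.image f → S.Nonempty →
      CanForce (caterpillar n m) B (whiteUnion (caterpillar n m) B S) (Sum.inl i.1)
        (Sum.inr ⟨i.1, lf i⟩) := by
    intro S
    by_cases h : S ⊆ Finset.univ.image f ∧ S.Nonempty
    · obtain ⟨i, hi⟩ := hforce S h.1 h.2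
      exact ⟨i, fun _ _ => hi⟩
    · exact ⟨hne.some, fun h1 h2 => absurd ⟨h1, h2⟩ h⟩
  choose g hg using hforce'
  refine .rule3 t B (Finset.univ.image f) ?_ (fun S => Sum.inl (g S).1)
    (fun S => Sum.inr ⟨(g S).1, lf (g S)⟩) hg fun S _ _ => H _ (hlf _)
  rw [Finset.card_image_of_injective _ hf, Finset.card_univ, Fintype.card_coe]
  omega

/-- Blue may play free moves until no vertex of the spine can force and at most `q` blue vertices
of the spine have white leaves. -/
theorem blueWins_of_stuck {q t : ℕ} (B : Set (CaterpillarVertex m)) (hB : Tame B)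
    (H : ∀ B', B ⊆ B' → Tame B' →
      (∀ i w, ¬ CanForce (caterpillar n m) B' B'ᶜ (Sum.inl i) w) → (leafy B').card ≤ q →
      BlueWins (caterpillar n m) q t B') : BlueWins (caterpillar n m) q t B := by
  induction hk : Bᶜ.ncard using Nat.strong_induction_on generalizing B with
  | _ k ih =>
    have step : ∀ w, w ∉ B → Tame (insert w B) →
        BlueWins (caterpillar n m) q t (insert w B) := by
      intro w hw hT
      refine ih _ ?_ (insert w B) hT
        (fun B' hB' => H B' ((Set.subset_insert _ _).trans hB')) rfl
      rw [← hk]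
      refine Set.ncard_lt_ncard ?_ (Set.toFinite _)
      exact compl_lt_compl_iff_lt.2 (Set.ssubset_insert hw)
    by_cases h2 : ∃ i w, CanForce (caterpillar n m) B Bᶜ (Sum.inl i) w
    · obtain ⟨i, w, h⟩ := h2
      exact .rule2 _ _ _ _ h (step w h.2.1 (hB.insert_force h))
    by_cases h3 : q < (leafy B).card
    · exact blueWins_of_lt_card_leafy h3 fun l hl => step _ hl (hB.insert_leaf l)
    · push Not at h2
      exact H B subset_rfl hB h2 (by omega)

/-! ### Halving the white runs -/

/-- A run after `l` has at most `N - 1` elements; cutting at `l + N / 2` and the next index leaves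
at most `N / 2 - 1` on either side. -/
theorem exists_not_of_halving {w w' : ℕ → Prop} {N : ℕ} (hN : 2 ≤ N) (h0 : ¬ w 0)
    (hrun : ∀ j, ∃ i, j ≤ i ∧ i < j + N ∧ ¬ w i) (hw : ∀ i, w' i → w i)
    (hcut : ∀ l, ¬ w l → w (l + 1) → ¬ w' (l + N / 2) ∧ ¬ w' (l + N / 2 + 1)) (j : ℕ) :
    ∃ i, j ≤ i ∧ i < j + N / 2 ∧ ¬ w' i := by
  classical
  by_contra! hj
  have hwj : ∀ i, j ≤ i → i < j + N / 2 → w i := fun i h1 h2 => hw i (hj i h1 h2)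
  set l := Nat.findGreatest (fun i => ¬ w i) j with hl
  have hlj : l ≤ j := Nat.findGreatest_le j
  have hl0 : ¬ w l := Nat.findGreatest_spec (P := fun i => ¬ w i) (Nat.zero_le j) h0
  have hlne : l ≠ j := fun h => hl0 (h ▸ hwj j le_rfl (by omega))
  have hall : ∀ i, l < i → i < j + N / 2 → w i := by
    intro i h1 h2
    by_cases hij : i ≤ j
    · have := Nat.findGreatest_is_greatest (P := fun i => ¬ w i) h1 hij
      exact not_not.1 this
    · exact hwj i (by omega) h2
  obtain ⟨c1, c2⟩ := hcut l hl0 (hall _ (by omega) (by omega))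
  obtain ⟨i, hi1, hi2, hi3⟩ := hrun (l + 1)
  have hi4 : j + N / 2 ≤ i := by
    by_contra h
    exact hi3 (hall i (by omega) (by omega))
  by_cases hc : j ≤ l + N / 2
  · exact c1 (hj _ hc (by omega))
  · exact c2 (hj _ (by omega) (by omega))

open Classical in
/-- The blue vertices of the spine at which a white run starts. -/
noncomputable def runStarts (B : Set (CaterpillarVertex m)) : Finset (Fin n) :=
  Finset.univ.filter fun l => ¬ SpineWhite B l.1 ∧ SpineWhite B (l.1 + 1)

open Classical in
-- The two blue ends of a run are leafy, since otherwise they could force into it. Tameness keeps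
-- the ends of different runs distinct.
theorem two_mul_card_runStarts_le {B : Set (CaterpillarVertex m)} (hB : Tame B)
    (hstuck : ∀ i w, ¬ CanForce (caterpillar n m) B Bᶜ (Sum.inl i) w) :
    2 * (runStarts B).card ≤ (leafy B).card := by
  set R : Finset (Fin n) :=
    Finset.univ.filter fun r => ¬ SpineWhite B r.1 ∧ 1 ≤ r.1 ∧ SpineWhite B (r.1 - 1) with hR
  have hdisj : Disjoint (runStarts B) R := by
    rw [Finset.disjoint_left]
    intro i hi hi'
    obtain ⟨-, h1, h2⟩ := Finset.mem_filter.1 hi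
    obtain ⟨-, -, h3, h4⟩ := Finset.mem_filter.1 hi'
    obtain ⟨k, hk⟩ : ∃ k, i.1 = k + 1 := ⟨i.1 - 1, by omega⟩
    rw [hk] at h1 h2 h4
    exact h1 (hB.between k h4 h2)
  have hleafy : ∀ i j : Fin n, ¬ SpineWhite B i.1 → SpineWhite B j.1 →
      (i.1 + 1 = j.1 ∨ j.1 + 1 = i.1) → i ∈ leafy B := by
    intro i j hi hj hij
    have hiB : (Sum.inl i : CaterpillarVertex m) ∈ B := (not_spineWhite_iff i.2).1 hi
    rw [mem_leafy]
    refine ⟨hiB, ?_⟩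
    by_contra! hl
    refine hstuck i (Sum.inl j) ⟨hiB, hj.2, caterpillar_adj_inl_inl.2 hij, ?_⟩
    rintro (k | l) hk hadj
    · rw [caterpillar_adj_inl_inl] at hadj
      by_contra hne
      have hne : k.1 ≠ j.1 := fun h => hne (by rw [Fin.ext h])
      have hkw : SpineWhite B k.1 := ⟨k.2, hk⟩
      rcases hij with h1 | h1 <;> rcases hadj with h2 | h2
      · omega
      · refine hi ?_
        have := hB.between k.1 hkw (by rwa [show k.1 + 2 = j.1 by omega])
        rwa [h2] at this
      · refine hi ?_
        have := hB.between j.1 hj (by rwa [show j.1 + 2 = k.1 by omega])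
        rwa [h1] at this
      · omega
    · obtain ⟨l, j'⟩ := l
      rw [caterpillar_adj_inl_inr] at hadj
      simp only at hadj
      subst hadj
      exact absurd (hl j') hk
  have hsub : runStarts B ∪ R ⊆ leafy B := by
    intro i hi
    rcases Finset.mem_union.1 hi with hi | hi
    · obtain ⟨-, h1, h2⟩ := Finset.mem_filter.1 hi
      exact hleafy i ⟨i.1 + 1, h2.1⟩ h1 h2 (Or.inl rfl)
    · obtain ⟨-, h1, h2, h3⟩ := Finset.mem_filter.1 hi
      exact hleafy i ⟨i.1 - 1, h3.1⟩ h1 h3 (Or.inr (by simp only; omega))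
  -- Send each start to the first non-white index after it; a later start would interrupt the run,
  -- so the map is injective.
  have hle : (runStarts B).card ≤ R.card := by
    have hex : ∀ l : Fin n, ∃ r : Fin n, l ∈ runStarts B →
        l < r ∧ r ∈ R ∧ ∀ i, l.1 < i → i < r.1 → SpineWhite B i := by
      intro l
      by_cases hl : l ∈ runStarts B
      · obtain ⟨-, h1, h2⟩ := Finset.mem_filter.1 hl
        have hex : ∃ r, l.1 < r ∧ ¬ SpineWhite B r := ⟨n, l.2, fun h => by have := h.1; omega⟩
        obtain ⟨hr1, hr2⟩ := Nat.find_spec hex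
        set r := Nat.find hex
        have hmin : ∀ i, l.1 < i → i < r → SpineWhite B i := fun i hi hir => by
          by_contra hw
          exact Nat.find_min hex hir ⟨hi, hw⟩
        have hr : l.1 + 1 ≠ r := fun h => hr2 (h ▸ h2)
        have hpred := hmin (r - 1) (by omega) (by omega)
        have hrn : r < n := by
          have := hB.last _ hpred
          omega
        exact ⟨⟨r, hrn⟩, fun _ => ⟨hr1, Finset.mem_filter.2
          ⟨Finset.mem_univ _, hr2, by simp only; omega, hpred⟩, hmin⟩⟩
      · exact ⟨l, fun h => absurd h hl⟩
    choose r hr using hex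
    refine Finset.card_le_card_of_injOn r (fun l hl => (hr l hl).2.1) ?_
    have hlt : ∀ l ∈ runStarts B, ∀ l' ∈ runStarts B, l < l' → r l ≠ r l' := by
      intro l hl l' hl' hll h
      refine (Finset.mem_filter.1 hl').2.1 ((hr l hl).2.2 l'.1 hll ?_)
      rw [h]
      exact (hr l' hl').1
    intro l hl l' hl' h
    by_contra hne
    rcases lt_or_gt_of_ne hne with h' | h'
    · exact hlt l hl l' hl' h' h
    · exact hlt l' hl' l hl h' h.symm
  have := Finset.card_le_card hsub
  rw [Finset.card_union_of_disjoint hdisj] at this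
  omega

/-! ### Blue's full strategy -/

open Classical in
theorem blueWins_of_spine_blue {q k : ℕ} (hm : ∀ i, m i ≤ k) {B : Set (CaterpillarVertex m)}
    (hB : Tame B) (hspine : ∀ i, ¬ SpineWhite B i) :
    BlueWins (caterpillar n m) q (q * (k - 1)) B := by
  refine blueWins_of_stuck B hB fun B hBB hB _ hq => ?_
  replace hspine : ∀ i, ¬ SpineWhite B i := fun i hi => hspine i (hi.anti hBB)
  -- All leaves but number 0 of each leafy vertex; the remaining one is then forced.
  let F : Finset (CaterpillarVertex m) := (leafy B).biUnion fun i =>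
    (Finset.univ.filter fun j : Fin (m i) => j.1 ≠ 0).image fun j => Sum.inr ⟨i, j⟩
  have hF : F.card ≤ q * (k - 1) := by
    refine (Finset.card_biUnion_le_card_mul _ _ (k - 1) fun i _ => ?_).trans
      (Nat.mul_le_mul_right _ hq)
    refine Finset.card_image_le.trans ?_
    rcases Nat.eq_zero_or_pos (m i) with h0 | h0
    · have : IsEmpty (Fin (m i)) := by rw [h0]; infer_instance
      simp [Finset.univ_eq_empty]
    · have : (Finset.univ.filter fun j : Fin (m i) => j.1 ≠ 0) ⊆
          Finset.univ.erase ⟨0, h0⟩ := by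
        intro j hj
        rw [Finset.mem_filter] at hj
        exact Finset.mem_erase.2 ⟨fun h => hj.2 (by rw [h]), Finset.mem_univ _⟩
      have := Finset.card_le_card this
      rw [Finset.card_erase_of_mem (Finset.mem_univ _), Finset.card_univ, Fintype.card_fin] at this
      have := hm i
      omega
  refine BlueWins.mono (t := 0 + F.card) (BlueWins.of_tokens F ?_) (by omega)
  refine blueWins_of_stuck _ (hB.of_spine Set.subset_union_left
    fun i hi => absurd hi (hspine i)) fun B' hBB' _ hstuck _ => ?_
  suffices B' = Set.univ by
    rw [this]
    exact .done _
  have hinl : ∀ i : Fin n, (Sum.inl i : CaterpillarVertex m) ∈ B' := fun i =>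
    hBB' (Or.inl ((not_spineWhite_iff i.2).1 (hspine i.1)))
  have hinr : ∀ (i : Fin n) (j : Fin (m i)), j.1 ≠ 0 →
      (Sum.inr ⟨i, j⟩ : CaterpillarVertex m) ∈ B' := by
    intro i j hj
    by_contra hB'
    have hnB : (Sum.inr ⟨i, j⟩ : CaterpillarVertex m) ∉ B := fun h => hB' (hBB' (Or.inl h))
    refine hB' (hBB' (Or.inr ?_))
    refine Finset.mem_coe.2 (Finset.mem_biUnion.2 ⟨i, mem_leafy.2
      ⟨(not_spineWhite_iff i.2).1 (hspine i.1), j, hnB⟩, ?_⟩)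
    exact Finset.mem_image.2 ⟨j, Finset.mem_filter.2 ⟨Finset.mem_univ _, hj⟩, rfl⟩
  rw [Set.eq_univ_iff_forall]
  rintro (i | ⟨i, j⟩)
  · exact hinl i
  · by_contra hj
    refine hstuck i (Sum.inr ⟨i, j⟩) ⟨hinl i, hj, rfl, ?_⟩
    rintro (i' | ⟨i', j'⟩) hu hadj
    · exact absurd (hinl i') hu
    · rw [caterpillar_adj_inl_inr] at hadj
      simp only at hadj
      subst hadj
      have h1 : j.1 = 0 := by
        by_contra h
        exact hj (hinr _ j h)
      have h2 : j'.1 = 0 := by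
        by_contra h
        exact hu (hinr _ j' h)
      rw [Fin.ext (h1.trans h2.symm)]

open Classical in
theorem blueWins_of_runs_lt {q k : ℕ} (hm : ∀ i, m i ≤ k) (N : ℕ) (hN : 1 ≤ N)
    (B : Set (CaterpillarVertex m)) (hB : Tame B)
    (hrun : ∀ j, ∃ i, j ≤ i ∧ i < j + N ∧ ¬ SpineWhite B i) :
    BlueWins (caterpillar n m) q (2 * (q / 2) * Nat.log 2 N + q * (k - 1)) B := by
  induction N using Nat.strong_induction_on generalizing B with
  | _ N ih =>
    rcases (by omega : N = 1 ∨ 2 ≤ N) with rfl | hN2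
    · refine (blueWins_of_spine_blue hm hB fun i => ?_).mono (Nat.le_add_left _ _)
      obtain ⟨j, h1, h2, h3⟩ := hrun i
      rwa [show j = i by omega] at h3
    refine blueWins_of_stuck B hB fun B hBB hB hstuck hq => ?_
    replace hrun : ∀ j, ∃ i, j ≤ i ∧ i < j + N ∧ ¬ SpineWhite B i := fun j =>
      let ⟨i, h1, h2, h3⟩ := hrun j
      ⟨i, h1, h2, fun h => h3 (h.anti hBB)⟩
    let f : ℕ → Finset (CaterpillarVertex m) := fun s =>
      (Finset.univ.filter fun i : Fin n => i.1 = s).image Sum.inl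
    have hf : ∀ s, (f s).card ≤ 1 := fun s => by
      refine Finset.card_image_le.trans (Finset.card_le_one.2 fun i hi j hj => ?_)
      exact Fin.ext ((Finset.mem_filter.1 hi).2.trans (Finset.mem_filter.1 hj).2.symm)
    let F : Finset (CaterpillarVertex m) :=
      (runStarts B).biUnion fun l => f (l.1 + N / 2) ∪ f (l.1 + N / 2 + 1)
    have hF : F.card ≤ 2 * (q / 2) := by
      have h1 : F.card ≤ (runStarts B).card * 2 :=
        Finset.card_biUnion_le_card_mul _ _ 2 fun l _ => (Finset.card_union_le _ _).trans
          (Nat.add_le_add (hf _) (hf _))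
      have := two_mul_card_runStarts_le hB hstuck
      omega
    have hmemF : ∀ i : Fin n, (Sum.inl i : CaterpillarVertex m) ∈ F ↔
        ∃ l ∈ runStarts B, i.1 = l.1 + N / 2 ∨ i.1 = l.1 + N / 2 + 1 := by
      intro i
      simp [F, f]
    have hcut : ∀ l ∈ runStarts B, ∀ s, (s = l.1 + N / 2 ∨ s = l.1 + N / 2 + 1) →
        ¬ SpineWhite (B ∪ F) s := by
      rintro l hl s hs ⟨h, hw⟩
      exact hw (Or.inr ((hmemF ⟨s, h⟩).2 ⟨l, hl, hs⟩))
    -- Tokens come in adjacent pairs, so none creates a lone blue vertex between white ones, even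
    -- where a pair overshoots its run.
    have hT : Tame (B ∪ F) := by
      refine hB.of_spine Set.subset_union_left fun i hi hi' hl hr => ?_
      have := ((not_spineWhite_iff hi.1).1 hi').resolve_left hi.2
      obtain ⟨l, hlA, h⟩ := (hmemF _).1 this
      simp only at h
      rcases h with h | h
      · exact hcut l hlA (i + 1) (by omega) hr
      · exact hcut l hlA (i - 1) (by omega) hl
    have hnext := ih (N / 2) (by omega) (by omega) (B ∪ F) hT
      (exists_not_of_halving hN2 hB.first hrun
        (fun i hi => hi.anti Set.subset_union_left) fun l h1 h2 => by
          have hl : (⟨l, by have := h2.1; omega⟩ : Fin n) ∈ runStarts B :=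
            Finset.mem_filter.2 ⟨Finset.mem_univ _, h1, h2⟩
          exact ⟨hcut _ hl _ (Or.inl rfl), hcut _ hl _ (Or.inr rfl)⟩)
    refine (BlueWins.of_tokens F hnext).mono ?_
    rw [Nat.log_of_one_lt_of_le (by norm_num) hN2]
    linarith [mul_add (2 * (q / 2)) (Nat.log 2 (N / 2)) 1]

open Classical in
theorem blueWins_empty {q k : ℕ} (hn : 1 ≤ n) (hm : ∀ i, m i ≤ k) :
    BlueWins (caterpillar n m) q (2 * (q / 2) * Nat.log 2 n + q * (k - 1) + 2) ∅ := by
  let F : Finset (CaterpillarVertex m) := {Sum.inl ⟨0, hn⟩, Sum.inl ⟨n - 1, by omega⟩}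
  have hmem : ∀ i : Fin n, (Sum.inl i : CaterpillarVertex m) ∈ F ↔ i.1 = 0 ∨ i.1 = n - 1 := by
    intro i
    simp [F, Fin.ext_iff]
  have hw : ∀ i, SpineWhite (∅ ∪ (F : Set (CaterpillarVertex m))) i ↔ 0 < i ∧ i + 1 < n := by
    intro i
    by_cases hi : i < n
    · rw [← not_iff_not, not_spineWhite_iff hi, Set.empty_union, Finset.mem_coe, hmem]
      simp only
      omega
    · exact ⟨fun h => absurd h.1 hi, fun h => by omega⟩
  have hT : Tame (∅ ∪ (F : Set (CaterpillarVertex m))) := by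
    constructor
    · intro i h0 h2
      rw [hw] at *
      omega
    · rw [hw]
      omega
    · intro i hi
      rw [hw] at hi
      omega
  have h := blueWins_of_runs_lt (q := q) hm n hn _ hT fun j => by
    rcases Nat.eq_zero_or_pos j with rfl | hj
    · exact ⟨0, le_rfl, by omega, by rw [hw]; omega⟩
    · exact ⟨j + n - 1, by omega, by omega, by rw [hw]; omega⟩
  exact (BlueWins.of_tokens F h).mono (Nat.add_le_add_left Finset.card_le_two _)

end Caterpillar

/-! ### Passing to real logarithms -/

theorem corollary4p20 (n k q x p : ℕ) (hn : 1 ≤ n) (hk : 2 ≤ k) (hq : 2 ≤ q)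
    (hx : x ≡ q + 1 [MOD 2]) (hp : p = q + 1 + x)
    (m : Fin n → ℕ) (hm : ∀ i, 2 ≤ m i ∧ m i ≤ k) :
    (3 ≤ q → 2 * Real.logb 3 2 * Real.logb 2 ((n : ℝ) / 200) - 2
        ≤ (qForcingNumber q (caterpillar n m) : ℝ)) ∧
      (qForcingNumber q (caterpillar n m) : ℝ)
        ≤ ((p : ℝ) - 2) * Real.logb 2 (n : ℝ) + (p : ℝ) + (k : ℝ) - (q : ℝ)
          + (q : ℝ) * ((k : ℝ) - 1) + 1 := by
  have hwin := blueWins_empty (q := q) (k := k) hn fun i => (hm i).2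
  refine ⟨fun hq3 => ?_, ?_⟩
  · have hlt := lt_of_blueWins_empty (fun i => (hm i).1) hn hq3
      (Nat.sInf_mem (s := {t | BlueWins (caterpillar n m) q t ∅}) ⟨_, hwin⟩)
    change (n : ℝ) < 3 * √3 ^ qForcingNumber q (caterpillar n m) at hlt
    set t := qForcingNumber q (caterpillar n m)
    have hn0 : (0 : ℝ) < n := by exact_mod_cast hn
    have hl3 : 0 < Real.log 3 := Real.log_pos (by norm_num)
    have hl2 : 0 < Real.log 2 := Real.log_pos (by norm_num)
    -- The `-2` in the claim absorbs the factor 3; the 200 is pure slack.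
    have hlog : Real.log (n / 200) ≤ Real.log (3 * √3 ^ t) :=
      Real.log_le_log (by positivity) (by linarith)
    rw [Real.log_mul (by norm_num) (by positivity), Real.log_pow,
      Real.log_sqrt (by norm_num)] at hlog
    have heq : 2 * Real.logb 3 2 * Real.logb 2 ((n : ℝ) / 200) =
        2 * Real.log (n / 200) / Real.log 3 := by
      simp only [Real.logb]
      field_simp
    rw [heq, sub_le_iff_le_add, div_le_iff₀ hl3]
    linarith
  · have hle : qForcingNumber q (caterpillar n m) ≤ _ := Nat.sInf_le hwin
    have hle' : (qForcingNumber q (caterpillar n m) : ℝ) ≤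
        (2 * (q / 2) : ℕ) * (Nat.log 2 n : ℝ) + q * ((k : ℝ) - 1) + 2 := by
      have := (Nat.cast_le (α := ℝ)).2 hle
      push_cast [Nat.cast_sub (by omega : 1 ≤ k)] at this ⊢
      exact this
    have hlog : (Nat.log 2 n : ℝ) ≤ Real.logb 2 n := by
      exact_mod_cast Real.natLog_le_logb n 2
    have hp2 : ((2 * (q / 2) : ℕ) : ℝ) ≤ (p : ℝ) - 2 := by
      -- The congruence makes `p` even, and `p ≥ q + 1`.
      have : 2 * (q / 2) + 2 ≤ p := by
        have := hx
        unfold Nat.ModEq at this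
        omega
      have := (Nat.cast_le (α := ℝ)).2 this
      push_cast at this ⊢
      linarith
    have hmul : ((2 * (q / 2) : ℕ) : ℝ) * (Nat.log 2 n : ℝ) ≤
        ((p : ℝ) - 2) * Real.logb 2 (n : ℝ) :=
      mul_le_mul hp2 hlog (Nat.cast_nonneg _) ((Nat.cast_nonneg _).trans hp2)
    have hk' : (2 : ℝ) ≤ k := by exact_mod_cast hk
    have hpq : (q : ℝ) + 1 ≤ p := by exact_mod_cast (by omega : q + 1 ≤ p)
    linarith
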